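/- **Setting.** Let $(\Theta,\mathcal T)$ and $(\Omega,\mathcal F)$ be measurable spaces and $(\mathbb P_\theta)_{\theta\in\Theta}$ a transition (probability) kernel from $\Theta$ to $\Omega$, with expectation $\mathbb E_\theta$, variance $\mathrm{Var}_\theta$ and law $\mathcal L_\theta$. All random variables below are jointly measurable functions $X=X(\theta,\omega)=X_\theta(\omega)$ on $\Theta\times\Omega$, real valued unless stated otherwise. Let $Y$ be a random variable with $\mathbb E_\theta Y^2<\infty$ for all $\theta$; put $\mu_\theta=\mathbb E_\theta Y$, $\sigma_\theta^2=\mathrm{Var}_\theta Y$, and $W=(Y-\mu_\theta)/\sigma_\theta$ if $\sigma_\theta>0$, $W=0$ otherwise. Majorants ($\overline G,\overline D,\overline B$ below) are thought of as nonnegative; in general, expectations involving them are read as expectations of the positive part of the variable in braces. $I_F$ is the indicator of $F$. Relations between random variables "on" an event are meant $\mathbb P_\theta$-almost surely. **Conditions.** (G1) $r:\Theta\to(0,\infty)$ is measurable, $\overline r>0$, $\Theta_0=\{\theta\in\Theta: r_\theta>\overline r\}$, and $\sigma^2_\theta>0$ for all $\theta\in\Theta_0$. (G2) $W'$ and $G$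 are random variables such that for each $\theta\in\Theta_0$ the triple $(W,W',G)$ is a Stein coupling under $\mathbb P_\theta$: $\mathbb E_\theta\{Gf(W')-Gf(W)\}=\mathbb E_\theta\{Wf(W)\}$ for all measurable $f:\mathbb R\to\mathbb R$ for which both expectations exist (that is, both variables in braces are integrable). (G3) With $D=W'-W$, $GD$ is $\mathbb P_\theta$-integrable for each $\theta\in\Theta_0$, and $$\sup_{\theta\in\Theta_0} r_\theta\,\mathbb E_\theta\bigl|\mathbb E_\theta(1-GD\mid W)\bigr|<\infty,\qquad \sup_{\theta\in\Theta_0} r_\theta\,\mathbb E_\theta\{(1+|W|)|G|D^2\}<\infty.$$ (G4) For each $\theta\in\Theta_0$, $\mathcal F_\theta\subset\mathcal F$ is a sub-$\sigma$-algebra; $\overline G,\overline D$ are random variables with $\overline G_\theta,\overline D_\theta$ $\mathcal F_\theta$-measurable for $\theta\in\Theta_0$; and there are events $F_{\theta,1}\in\mathcal F$ (not necessarily in $\mathcal F_\theta$) on which $|G|\le\overline G$ and $|D|\le\overline D$, with $$\sup_{\theta\in\Theta_0} r_\theta^2\,\mathbb E_\theta\{|G|D^2(1-I_{F_{\theta,1}})\}<\infty,\qquad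 \sup_{\theta\in\Theta_0} r_\theta\,\mathbb E_\theta\{\overline G\,\overline D^2\}<\infty.$$ (G5) $\Psi$ is a $\Theta$-valued random element (jointly measurable in $(\theta,\omega)$) with $\Psi_\theta$ $\mathcal F_\theta$-measurable for each $\theta\in\Theta_0$; $V$ is a random variable; and for each $\theta\in\Theta_0$ there is $F_{\theta,2}\in\mathcal F_\theta$ with $\mathcal L_\theta(V\mid\mathcal F_\theta)=\mathcal L_{\Psi_\theta}(Y)$ on $F_{\theta,2}$, that is, for every Borel set $A$, $\mathbb P_\theta[V\in A\mid\mathcal F_\theta](\omega)=\mathbb P_{\Psi_\theta(\omega)}[Y\in A]$ for $\mathbb P_\theta$-almost all $\omega\in F_{\theta,2}$; and $$\sup_{\theta\in\Theta_0} r_\theta^2\,\mathbb E_\theta\{|G|D^2(1-I_{F_{\theta,2}})\}<\infty.$$ (G6) $\overline B$ is a random variable with $\overline B_\theta$ $\mathcal F_\theta$-measurable for each $\theta\in\Theta_0$, with $\sigma_\theta^{-1}|Y-V|\le\overline B$ on $F_{\theta,1}$ for each $\theta\in\Theta_0$, and $$\sup_{\theta\in\Theta_0} r_\theta^2\,\mathbb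 E_\theta\{\overline G\,\overline D^2\,\overline B\,I_{F_{\theta,2}}\}<\infty.$$ (G7) With essential suprema taken with respect to $\mathbb P_\theta$, $$\sup_{\theta\in\Theta_0}\operatorname*{ess\,sup}_{\omega\in F_{\theta,2}\cap\{\Psi_\theta\in\Theta_0\}}\frac{\sigma_\theta^2}{\sigma^2_{\Psi_\theta(\omega)}}<\infty,\quad \sup_{\theta\in\Theta_0}\operatorname*{ess\,sup}_{\omega\in F_{\theta,2}}\frac{r_\theta}{r_{\Psi_\theta(\omega)}}<\infty,\quad \sup_{\theta\in\Theta_0}\operatorname*{ess\,sup}_{\omega\in F_{\theta,2}\cap\{\Psi_\theta\in\Theta_0\}}\frac{r_{\Psi_\theta(\omega)}}{r_\theta}<\infty.$$ **Theorem.** If (G1)–(G7) hold, then there is a constant $C$, independent of $\theta$, such that, with $Z$ a standard normal random variable, $$\sup_{z\in\mathbb R}\bigl|\mathbb P_\theta[W\le z]-\mathbb P[Z\le z]\bigr|\le\frac{C}{r_\theta}\qquad\text{for all }\theta\in\Theta.$$ -/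

import Mathlib

open MeasureTheory ProbabilityTheory
open scoped ENNReal

noncomputable section

/-- The set of well-behaved parameters, `{θ | r θ > rbar}`. -/
def goodSet {Θ : Type*} (r : Θ → ℝ) (rbar : ℝ) : Set Θ := {θ | rbar < r θ}

/-- `W θ = (Y θ - μ_θ) / σ_θ` if `σ_θ > 0`, and `W θ = 0` otherwise, where `μ_θ` and `σ_θ²` are the
mean and the variance of `Y θ` under `P θ`. -/
def standardize {Θ Ω : Type*} [MeasurableSpace Θ] [MeasurableSpace Ω]
    (P : Kernel Θ Ω) (Y : Θ → Ω → ℝ) (θ : Θ) (ω : Ω) : ℝ :=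
  open Classical in
  if 0 < Var[Y θ; P θ] then (Y θ ω - ∫ ω', Y θ ω' ∂(P θ)) / √Var[Y θ; P θ] else 0

/-- The difference `D = W' - W`, where `W` is the standardized version of `Y`. -/
def couplingDiff {Θ Ω : Type*} [MeasurableSpace Θ] [MeasurableSpace Ω]
    (P : Kernel Θ Ω) (Y W' : Θ → Ω → ℝ) (θ : Θ) (ω : Ω) : ℝ :=
  W' θ ω - standardize P Y θ ω

/-- `(W, W', G)` is a Stein coupling under `μ`: `E {G f(W') - G f(W)} = E {W f(W)}` for all
(measurable) `f` for which these two expectations exist. -/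
def IsSteinCoupling {Ω : Type*} [MeasurableSpace Ω] (μ : Measure Ω) (W W' G : Ω → ℝ) : Prop :=
  ∀ f : ℝ → ℝ, Measurable f →
    Integrable (fun ω => G ω * f (W' ω) - G ω * f (W ω)) μ →
    Integrable (fun ω => W ω * f (W ω)) μ →
    ∫ ω, (G ω * f (W' ω) - G ω * f (W ω)) ∂μ = ∫ ω, W ω * f (W ω) ∂μ

/-- The expectation of a nonnegative random variable, as an element of `[0, ∞]`.
(If `X` takes negative values, this is the expectation of its positive part.) -/
def posExp {Ω : Type*} [MeasurableSpace Ω] (μ : Measure Ω) (X : Ω → ℝ) : ℝ≥0∞ :=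
  ∫⁻ ω, ENNReal.ofReal (X ω) ∂μ

/-- `ess sup_{ω ∈ S} X ω` with respect to `μ`, for a nonnegative `X`, as an element of `[0, ∞]`
(it is `0` if `S` is a null set). -/
def essSupOn {Ω : Type*} [MeasurableSpace Ω] (μ : Measure Ω) (S : Set Ω) (X : Ω → ℝ) : ℝ≥0∞ :=
  essSup (fun ω => ENNReal.ofReal (X ω)) (μ.restrict S)

/-- The conditional law of `V` given the sub-σ-algebra `m` is, at almost every point `ω` of the
event `F`, the probability measure `ν ω`. -/
def HasCondLawOn {Ω : Type*} [m0 : MeasurableSpace Ω] (μ : Measure Ω) (m : MeasurableSpace Ω)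
    (V : Ω → ℝ) (F : Set Ω) (ν : Ω → Measure ℝ) : Prop :=
  ∀ A : Set ℝ, MeasurableSet A →
    ∀ᵐ ω ∂μ, ω ∈ F → (μ⟦V ⁻¹' A | m⟧) ω = (ν ω).real A

end

/-! Stein's method with a bootstrap over the parameter. Let h be a ramp of width ε replacing the
indicator of (-∞, z], N its Gaussian mean, and f the bounded solution of f' = x f + h - N. The Stein
coupling gives E h(W) - N = E f'(W)(1 - GD) - E G R, where R = f(W') - f(W) - D f'(W). Since f' is
bounded and a function of W, the first term only sees E(1 - GD | W). In R, the part of f' other than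
h costs (1 + |W|) D², and the variation of h costs |D| min(1, |D|/ε), but only when W is within ε +
|D| of z (`abs_stein_remainder_le`, `IsSteinCoupling.smoothInd_error_le`).

The remaining task is to bound the probability of this interval in the presence of the weight in G
and D. On F₁ ∩ F₂ the weight and the half-width are replaced by ℱ-measurable majorants, and Y by V
at the price of widening the interval by the majorant of |Y - V|/σ (`posExp_indicator_le`). Given ℱ,
V has the law of Y under the parameter Ψ, so the interval has conditional probability at most a
multiple of its length plus twice the Kolmogorov error at Ψ (`lintegral_indicator_Ioc_le`).

The error at θ is thus bounded by errors at other parameters. Let K bound min(r, n) times the error,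
uniformly in the parameter. Because r at θ and at Ψ are comparable, smoothing with ε = A/r for a
large fixed A turns the bound K into C + K/2 (`mul_le_of_smoothing_parameter`). The truncation at n
makes the best K finite, so K ≤ 2C, with C independent of n (`mul_le_of_self_improving`). Parameters
with r ≤ rbar are covered by the trivial bound 1. -/

/-! ### Smoothed indicators -/

/-- The continuous function that is `1` on `(-∞, z]`, `0` on `[z + ε, ∞)` and affine in between. -/
noncomputable def smoothInd (z ε x : ℝ) : ℝ := max 0 (min 1 ((z + ε - x) / ε))

lemma continuous_smoothInd (z ε : ℝ) : Continuous (smoothInd z ε) := by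
  unfold smoothInd
  fun_prop

lemma smoothInd_nonneg (z ε x : ℝ) : 0 ≤ smoothInd z ε x := le_max_left _ _

lemma smoothInd_le_one (z ε x : ℝ) : smoothInd z ε x ≤ 1 :=
  max_le zero_le_one (min_le_left _ _)

lemma smoothInd_of_le {z ε x : ℝ} (hε : 0 < ε) (hx : x ≤ z) : smoothInd z ε x = 1 := by
  have h : 1 ≤ (z + ε - x) / ε := by rw [le_div_iff₀ hε]; linarith
  simp [smoothInd, min_eq_left h]

lemma smoothInd_of_ge {z ε x : ℝ} (hε : 0 < ε) (hx : z + ε ≤ x) : smoothInd z ε x = 0 := by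
  have h : (z + ε - x) / ε ≤ 0 := div_nonpos_of_nonpos_of_nonneg (by linarith) hε.le
  exact max_eq_left ((min_le_right _ _).trans h)

lemma abs_smoothInd_sub_le_div {z ε : ℝ} (hε : 0 < ε) (x y : ℝ) :
    |smoothInd z ε x - smoothInd z ε y| ≤ |x - y| / ε := by
  unfold smoothInd
  refine (abs_max_sub_max_le_max _ _ _ _).trans ?_
  rw [sub_self, abs_zero]
  refine max_le (by positivity) ((abs_min_sub_min_le_max _ _ _ _).trans ?_)
  rw [sub_self, abs_zero]
  refine max_le (by positivity) (le_of_eq ?_)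
  rw [← sub_div, abs_div, abs_of_pos hε, abs_sub_comm x y]
  congr 2
  ring

/-- The ramp varies only on [z, z + ε], so a shift by at most d is felt only near it. The interval
is taken symmetric about z, which is wider than necessary. The minimum combines the range [0, 1]
with the Lipschitz constant 1/ε; both bounds are needed when the interval is integrated out. -/
lemma abs_smoothInd_sub_le {z ε : ℝ} (hε : 0 < ε) {x t d : ℝ} (ht : |t| ≤ d) :
    |smoothInd z ε (x + t) - smoothInd z ε x| ≤
      min 1 (d / ε) * (Set.Ioc (z - ε - d) (z + ε + d)).indicator 1 x := by
  have ht' := abs_le.mp ht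
  by_cases hx : x ∈ Set.Ioc (z - ε - d) (z + ε + d)
  · rw [Set.indicator_of_mem hx, Pi.one_apply, mul_one]
    refine le_min ?_ ((abs_smoothInd_sub_le_div hε _ _).trans ?_)
    · rw [abs_le]
      constructor <;> linarith [smoothInd_nonneg z ε x, smoothInd_nonneg z ε (x + t),
        smoothInd_le_one z ε x, smoothInd_le_one z ε (x + t)]
    · rw [add_sub_cancel_left]
      gcongr
  · rw [Set.indicator_of_notMem hx, mul_zero]
    rw [Set.mem_Ioc, not_and_or, not_lt, not_le] at hx
    rcases hx with hx | hx
    · rw [smoothInd_of_le hε (by linarith), smoothInd_of_le hε (by linarith)]; simp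
    · rw [smoothInd_of_ge hε (by linarith), smoothInd_of_ge hε (by linarith)]; simp

/-! ### Gaussian tails and the Stein equation -/

lemma integrable_exp_neg_sq_half : Integrable (fun t : ℝ => Real.exp (-t ^ 2 / 2)) := by
  have h := integrable_exp_neg_mul_sq (b := 1 / 2) (by norm_num)
  refine h.congr (.of_forall fun t => ?_)
  simp only
  congr 1
  ring

lemma integral_exp_neg_sq_half_le : ∫ t : ℝ, Real.exp (-t ^ 2 / 2) ≤ 3 := by
  have h := integral_gaussian (1 / 2)
  have h' : (fun t : ℝ => Real.exp (-t ^ 2 / 2)) = fun t => Real.exp (-(1 / 2) * t ^ 2) := by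
    ext t
    congr 1
    ring
  rw [h', h, Real.sqrt_le_left (by norm_num)]
  have := Real.pi_lt_d2
  linarith

/-- Gaussian integration in terms of Lebesgue measure. -/
lemma integral_gaussianReal_std (h : ℝ → ℝ) :
    ∫ x, h x ∂(gaussianReal 0 1) = (√(2 * Real.pi))⁻¹ * ∫ x, h x * Real.exp (-x ^ 2 / 2) := by
  rw [integral_gaussianReal_eq_integral_smul (by norm_num), ← integral_const_mul]
  congr 1
  ext x
  simp [gaussianPDFReal]
  ring

/-- The Mills ratio bound on the left tail. -/
lemma mul_setIntegral_Iic_exp_le (x : ℝ) :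
    -x * ∫ t in Set.Iic x, Real.exp (-t ^ 2 / 2) ≤ Real.exp (-x ^ 2 / 2) := by
  have hd : ∀ t : ℝ, HasDerivAt (fun t => Real.exp (-t ^ 2 / 2))
      (-t * Real.exp (-t ^ 2 / 2)) t := fun t => by
    have h2 : HasDerivAt (fun t : ℝ => -t ^ 2 / 2) (-t) t := by
      have := (hasDerivAt_pow 2 t).fun_neg.div_const 2
      refine this.congr_deriv ?_
      push_cast
      ring
    simpa only [mul_comm] using h2.exp
  have hlim : Filter.Tendsto (fun t : ℝ => Real.exp (-t ^ 2 / 2)) Filter.atBot (nhds 0) := by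
    have h2 : Filter.Tendsto (fun t : ℝ => t ^ 2) Filter.atBot Filter.atTop := by
      simpa [Function.comp_def] using
        (Filter.tendsto_pow_atTop (α := ℝ) two_ne_zero).comp Filter.tendsto_neg_atBot_atTop
    exact Real.tendsto_exp_atBot.comp
      ((Filter.tendsto_neg_atTop_atBot.comp h2).atBot_div_const (by norm_num : (0 : ℝ) < 2))
  have hint : IntegrableOn (fun t : ℝ => -t * Real.exp (-t ^ 2 / 2)) (Set.Iic x) := by
    have h := integrable_mul_exp_neg_mul_sq (b := 1 / 2) (by norm_num)
    refine (h.neg.congr (.of_forall fun t => ?_)).integrableOn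
    simp only [Pi.neg_apply, neg_mul, neg_inj]
    congr 2
    ring
  have hI := integral_Iic_of_hasDerivAt_of_tendsto' (a := x) (fun t _ => hd t) hint hlim
  rw [sub_zero] at hI
  rw [← hI, ← integral_const_mul]
  refine setIntegral_mono_on (integrable_exp_neg_sq_half.integrableOn.const_mul _) hint
    measurableSet_Iic fun t ht => ?_
  have : t ≤ x := ht
  gcongr

lemma mul_setIntegral_Ioi_exp_le (x : ℝ) :
    x * ∫ t in Set.Ioi x, Real.exp (-t ^ 2 / 2) ≤ Real.exp (-x ^ 2 / 2) := by
  have h := mul_setIntegral_Iic_exp_le (-x)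
  have h2 := integral_comp_neg_Iic (-x) (fun t : ℝ => Real.exp (-t ^ 2 / 2))
  simp only [neg_sq, neg_neg] at h h2
  rwa [h2] at h

/-- The bounded solution of the Stein equation. -/
lemma exists_stein_solution {h : ℝ → ℝ} (hc : Continuous h) (h0 : ∀ x, 0 ≤ h x)
    (h1 : ∀ x, h x ≤ 1) :
    ∃ f : ℝ → ℝ,
      (∀ x, HasDerivAt f (x * f x + (h x - ∫ y, h y ∂(gaussianReal 0 1))) x) ∧
      (∀ x, |f x| ≤ 8) ∧ (∀ x, |x * f x| ≤ 1) := by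
  set N := ∫ y, h y ∂(gaussianReal 0 1) with hN
  have hint : Integrable h (gaussianReal 0 1) :=
    Integrable.of_bound hc.aestronglyMeasurable 1
      (.of_forall fun x => by rw [Real.norm_eq_abs, abs_of_nonneg (h0 x)]; exact h1 x)
  have hN0 : 0 ≤ N := integral_nonneg h0
  have hN1 : N ≤ 1 := by
    calc N ≤ ∫ y, (1 : ℝ) ∂(gaussianReal 0 1) := integral_mono hint (integrable_const _) h1
      _ = 1 := by simp
  set g : ℝ → ℝ := fun t => (h t - N) * Real.exp (-t ^ 2 / 2) with hg
  have hgc : Continuous g := by fun_prop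
  have hgb : ∀ t, |g t| ≤ Real.exp (-t ^ 2 / 2) := fun t => by
    rw [hg, abs_mul, Real.abs_exp]
    refine mul_le_of_le_one_left (Real.exp_pos _).le ?_
    rw [abs_le]
    constructor <;> linarith [h0 t, h1 t]
  have hgi : Integrable g := integrable_exp_neg_sq_half.mono' hgc.aestronglyMeasurable
    (.of_forall hgb)
  have hg0 : ∫ t, g t = 0 := by
    have e1 := integral_gaussianReal_std (fun t => h t - N)
    rw [integral_sub hint (integrable_const _)] at e1
    simp only [integral_const, probReal_univ, one_smul, ← hN, sub_self] at e1
    have := mul_eq_zero.mp e1.symm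
    rcases this with h' | h'
    · have : (0 : ℝ) < (√(2 * Real.pi))⁻¹ := by positivity
      linarith
    · exact h'
  have hle : ∀ s : Set ℝ, |∫ t in s, g t| ≤ ∫ t in s, Real.exp (-t ^ 2 / 2) := fun s =>
    (norm_integral_le_integral_norm _).trans
      (integral_mono hgi.norm.integrableOn integrable_exp_neg_sq_half.integrableOn hgb)
  have hle3 : ∀ s : Set ℝ, ∫ t in s, Real.exp (-t ^ 2 / 2) ≤ 3 := fun s =>
    (setIntegral_le_integral integrable_exp_neg_sq_half
      (.of_forall fun t => (Real.exp_pos _).le)).trans integral_exp_neg_sq_half_le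
  -- Centring by N makes the total integral of g vanish, so the integral up to x is also minus the
  -- right tail. Whichever tail lies on the side of x is then controlled by the Mills ratio.
  have hcompl : ∀ x, ∫ t in Set.Iic x, g t = -∫ t in Set.Ioi x, g t := fun x => by
    have := intervalIntegral.integral_Iic_add_Ioi (b := x) hgi.integrableOn hgi.integrableOn
    linarith
  set I : ℝ → ℝ := fun x => ∫ t in Set.Iic x, g t with hI
  have hId : ∀ x, HasDerivAt I (g x) x := fun x => by
    have e : I = fun x => (∫ t in Set.Iic (0 : ℝ), g t) + ∫ t in (0 : ℝ)..x, g t := by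
      ext y
      have := intervalIntegral.integral_Iic_sub_Iic (a := 0) (b := y) hgi.integrableOn
        hgi.integrableOn
      simp only [hI]
      linarith
    rw [e]
    exact (intervalIntegral.integral_hasDerivAt_right (hgc.intervalIntegrable _ _)
      (hgc.stronglyMeasurableAtFilter _ _) hgc.continuousAt).const_add _
  have hexp : ∀ x : ℝ, Real.exp (x ^ 2 / 2) * Real.exp (-x ^ 2 / 2) = 1 := fun x => by
    rw [← Real.exp_add, ← Real.exp_zero]
    congr 1
    ring
  have hxf : ∀ x, |x * (Real.exp (x ^ 2 / 2) * I x)| ≤ 1 := fun x => by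
    have key : |x| * |I x| ≤ Real.exp (-x ^ 2 / 2) := by
      rcases le_total x 0 with hx | hx
      · rw [abs_of_nonpos hx]
        exact (mul_le_mul_of_nonneg_left (hle _) (by linarith)).trans
          (mul_setIntegral_Iic_exp_le x)
      · rw [abs_of_nonneg hx]
        simp only [hI]
        rw [hcompl, abs_neg]
        exact (mul_le_mul_of_nonneg_left (hle _) hx).trans (mul_setIntegral_Ioi_exp_le x)
    calc |x * (Real.exp (x ^ 2 / 2) * I x)| = Real.exp (x ^ 2 / 2) * (|x| * |I x|) := by
          rw [abs_mul, abs_mul, Real.abs_exp]; ring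
      _ ≤ Real.exp (x ^ 2 / 2) * Real.exp (-x ^ 2 / 2) := by gcongr
      _ = 1 := hexp x
  refine ⟨fun x => Real.exp (x ^ 2 / 2) * I x, fun x => ?_, fun x => ?_, hxf⟩
  · have h1 : HasDerivAt (fun x : ℝ => Real.exp (x ^ 2 / 2)) (Real.exp (x ^ 2 / 2) * x) x := by
      convert ((hasDerivAt_pow 2 x).div_const 2).exp using 1
      simp
    refine (h1.fun_mul (hId x)).congr_deriv ?_
    simp only [hg]
    linear_combination (h x - N) * hexp x
  -- For |x| ≥ 1 the bound on x f(x) already gives 1; for |x| ≤ 1 the two factors are at most 2 and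
  -- 3. The constant 8 is not sharp.
  · rcases le_total 1 |x| with hx | hx
    · have := hxf x
      rw [abs_mul] at this
      nlinarith [abs_nonneg (Real.exp (x ^ 2 / 2) * I x)]
    · have h3 : |I x| ≤ 3 := (hle _).trans (hle3 _)
      have hx2 : x ^ 2 ≤ 1 := by rwa [sq_le_one_iff_abs_le_one]
      have he : Real.exp (x ^ 2 / 2) ≤ 2 := by
        rw [← Real.sqrt_sq (by norm_num : (0 : ℝ) ≤ 2)]
        refine Real.le_sqrt_of_sq_le ?_
        rw [← Real.exp_nat_mul]
        have : Real.exp ((2 : ℕ) * (x ^ 2 / 2)) ≤ Real.exp 1 := by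
          apply Real.exp_le_exp.mpr
          push_cast
          linarith
        linarith [Real.exp_one_lt_d9]
      rw [abs_mul, Real.abs_exp]
      nlinarith [abs_nonneg (I x), Real.exp_pos (x ^ 2 / 2)]

/-- Second-order expansion of a solution of the Stein equation for a smoothed indicator. -/
lemma abs_stein_remainder_le {z ε N : ℝ} (hε : 0 < ε) {f : ℝ → ℝ} {f' : ℝ → ℝ}
    (hf : ∀ x, HasDerivAt f (f' x) x) (hf' : ∀ x, f' x = x * f x + (smoothInd z ε x - N))
    (hb : ∀ x, |f x| ≤ 8) (hb' : ∀ x, |f' x| ≤ 2) (x d : ℝ) :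
    |f (x + d) - f x - d * f' x| ≤ 8 * ((1 + |x|) * d ^ 2) +
      |d| * (min 1 (|d| / ε) * (Set.Ioc (z - ε - |d|) (z + ε + |d|)).indicator 1 x) := by
  have hlip : ∀ x y, |f y - f x| ≤ 2 * |y - x| := fun x y =>
    convex_univ.norm_image_sub_le_of_norm_hasDerivWithin_le
      (fun u _ => (hf u).hasDerivWithinAt) (fun u _ => hb' u) (Set.mem_univ _) (Set.mem_univ _)
  set M := min 1 (|d| / ε) * (Set.Ioc (z - ε - |d|) (z + ε + |d|)).indicator (1 : ℝ → ℝ) x with hM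
  have hvar : ∀ t, |t| ≤ |d| → |f' (x + t) - f' x| ≤ 8 * ((1 + |x|) * |d|) + M := fun t ht => by
    -- The Stein equation replaces a second derivative, which f need not have: only the ramp term is
    -- rough.
    have e : f' (x + t) - f' x = x * (f (x + t) - f x) + t * f (x + t) +
        (smoothInd z ε (x + t) - smoothInd z ε x) := by
      rw [hf', hf']; ring
    have h1 : |x * (f (x + t) - f x)| ≤ |x| * (2 * |d|) := by
      rw [abs_mul]
      have := hlip x (x + t)
      rw [add_sub_cancel_left] at this
      gcongr
      linarith
    have h2 : |t * f (x + t)| ≤ |d| * 8 := by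
      rw [abs_mul]
      gcongr
      exact hb _
    have h3 := abs_smoothInd_sub_le (z := z) hε (x := x) ht
    rw [e]
    refine (abs_add_three _ _ _).trans ?_
    nlinarith [mul_nonneg (abs_nonneg x) (abs_nonneg d)]
  -- Mean value inequality for f minus its linear part at x, whose derivative is f' y - f' x.
  have hmv := (convex_uIcc x (x + d)).norm_image_sub_le_of_norm_hasDerivWithin_le
    (f := fun y => f y - f' x * y) (f' := fun y => f' y - f' x) (C := 8 * ((1 + |x|) * |d|) + M)
    (x := x) (y := x + d)
    (fun u _ => ((hf u).sub (by simpa using (hasDerivAt_id u).const_mul (f' x))).hasDerivWithinAt)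
    (fun u hu => by
      have hu' : |u - x| ≤ |d| := by
        have := Set.abs_sub_left_of_mem_uIcc hu
        rwa [add_sub_cancel_left] at this
      have := hvar (u - x) hu'
      rwa [add_sub_cancel] at this)
    Set.left_mem_uIcc Set.right_mem_uIcc
  simp only [Real.norm_eq_abs, add_sub_cancel_left] at hmv
  calc |f (x + d) - f x - d * f' x| = |f (x + d) - f' x * (x + d) - (f x - f' x * x)| := by
        congr 1; ring
    _ ≤ _ := hmv
    _ = _ := by rw [← sq_abs d]; ring

/-! ### Conditional laws and disintegration -/

/-- Integration against a conditional law, tested on rectangles. -/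
lemma lintegral_eq_lintegral_kernel {Ω S : Type*} [MeasurableSpace Ω] [MeasurableSpace S]
    {ν : Measure Ω} [IsFiniteMeasure ν] {X : Ω → S} {V : Ω → ℝ} (hX : Measurable X)
    (hV : Measurable V) (κ : Kernel S ℝ) [IsFiniteKernel κ]
    (h : ∀ B : Set S, MeasurableSet B → ∀ A : Set ℝ, MeasurableSet A →
      ν (X ⁻¹' B ∩ V ⁻¹' A) = ∫⁻ ω in X ⁻¹' B, κ (X ω) A ∂ν)
    {g : S × ℝ → ℝ≥0∞} (hg : Measurable g) :
    ∫⁻ ω, g (X ω, V ω) ∂ν = ∫⁻ ω, ∫⁻ y, g (X ω, y) ∂(κ (X ω)) ∂ν := by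
  have key : ν.map (fun ω => (X ω, V ω)) = (ν.map X) ⊗ₘ κ := by
    refine Measure.ext_prod fun {s t} hs ht => ?_
    rw [Measure.map_apply (hX.prodMk hV) (hs.prod ht), Measure.compProd_apply_prod hs ht,
      setLIntegral_map hs (κ.measurable_coe ht) hX, ← h s hs t ht]
    rfl
  rw [← lintegral_map hg (hX.prodMk hV), key, Measure.lintegral_compProd hg,
    lintegral_map hg.lintegral_kernel_prod_right' hX]

/-- Rectangle form of `HasCondLawOn` on an event of the conditioning σ-algebra. -/
lemma HasCondLawOn.measure_inter_eq {Ω : Type*} {m m0 : MeasurableSpace Ω}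
    {μ : Measure Ω} [IsProbabilityMeasure μ] (hm : m ≤ m0) {V : Ω → ℝ}
    (hV : Measurable V) {F : Set Ω} (hF : MeasurableSet[m] F) {ν : Ω → Measure ℝ}
    [∀ ω, IsProbabilityMeasure (ν ω)] (h : HasCondLawOn μ m V F ν)
    {B : Set Ω} (hB : MeasurableSet[m] B) {A : Set ℝ} (hA : MeasurableSet A) :
    (μ.restrict F) (B ∩ V ⁻¹' A) = ∫⁻ ω in B, ν ω A ∂(μ.restrict F) := by
  have hBF : MeasurableSet[m] (B ∩ F) := hB.inter hF
  have hVA : MeasurableSet (V ⁻¹' A) := hV hA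
  have hae : ∀ᵐ ω ∂μ.restrict (B ∩ F), (μ⟦V ⁻¹' A | m⟧) ω = (ν ω).real A := by
    rw [ae_restrict_iff' (hm _ hBF)]
    filter_upwards [h A hA] with ω hω hmem using hω hmem.2
  have hint : Integrable ((V ⁻¹' A).indicator fun _ => (1 : ℝ)) μ :=
    (integrable_const 1).indicator hVA
  have e1 : ∫ ω in B ∩ F, (μ⟦V ⁻¹' A | m⟧) ω ∂μ = μ.real (V ⁻¹' A ∩ (B ∩ F)) := by
    rw [setIntegral_condExp hm hint hBF, integral_indicator hVA]
    simp [measureReal_restrict_apply hVA]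
  rw [Measure.restrict_restrict (hm _ hB), Measure.restrict_apply ((hm _ hB).inter hVA)]
  calc μ (B ∩ V ⁻¹' A ∩ F) = ENNReal.ofReal (μ.real (V ⁻¹' A ∩ (B ∩ F))) := by
        rw [ofReal_measureReal]
        congr 1
        ext ω
        simp only [Set.mem_inter_iff]
        tauto
    _ = ∫⁻ ω in B ∩ F, ENNReal.ofReal ((μ⟦V ⁻¹' A | m⟧) ω) ∂μ := by
        rw [← e1, ofReal_integral_eq_lintegral_ofReal integrable_condExp.integrableOn]
        filter_upwards [hae] with ω hω
        rw [hω]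
        exact measureReal_nonneg
    _ = ∫⁻ ω in B ∩ F, ν ω A ∂μ := by
        refine lintegral_congr_ae ?_
        filter_upwards [hae] with ω hω
        rw [hω, ofReal_measureReal]

/-- The kernel `θ ↦ law of Y θ under P θ`. -/
lemma exists_kernel_law {Θ Ω : Type*} [MeasurableSpace Θ] [MeasurableSpace Ω]
    (P : Kernel Θ Ω) [IsMarkovKernel P] {Y : Θ → Ω → ℝ} (hY : Measurable (Function.uncurry Y)) :
    ∃ κ : Kernel Θ ℝ, IsMarkovKernel κ ∧ ∀ θ, κ θ = (P θ).map (Y θ) := by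
  -- Pushing the product of the point mass at θ with P θ forward by the uncurried Y converts joint
  -- measurability into measurability of the law in θ.
  refine ⟨(Kernel.id ×ₖ P).map (Function.uncurry Y), Kernel.IsMarkovKernel.map _ hY, fun θ => ?_⟩
  ext A hA
  rw [Kernel.map_apply' _ hY _ hA, Measure.map_apply (hY.of_uncurry_left) hA,
    Kernel.id_prod_apply' _ _ (hY hA)]
  rfl

/-! ### Kolmogorov distance: concentration and smoothing -/

lemma gaussianReal_real_Ioc_le {a b : ℝ} (hab : a ≤ b) :
    (gaussianReal 0 1).real (Set.Ioc a b) ≤ b - a := by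
  have hpdf : ∀ x, gaussianPDF 0 1 x ≤ 1 := fun x => by
    rw [gaussianPDF, ← ENNReal.ofReal_one]
    refine ENNReal.ofReal_le_ofReal ?_
    rw [gaussianPDFReal]
    refine mul_le_one₀ ?_ (Real.exp_pos _).le ?_
    · refine inv_le_one_of_one_le₀ (Real.one_le_sqrt.mpr ?_)
      have := Real.pi_gt_three
      push_cast
      linarith
    · rw [Real.exp_le_one_iff]
      exact div_nonpos_of_nonpos_of_nonneg (neg_nonpos.mpr (sq_nonneg _)) (by positivity)
  refine ENNReal.toReal_le_of_le_ofReal (by linarith) ?_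
  rw [gaussianReal_apply _ one_ne_zero]
  calc ∫⁻ x in Set.Ioc a b, gaussianPDF 0 1 x ≤ ∫⁻ x in Set.Ioc a b, 1 :=
        lintegral_mono fun x => hpdf x
    _ = ENNReal.ofReal (b - a) := by simp

lemma measureReal_Iic_sub {μ : Measure ℝ} [IsFiniteMeasure μ] {a b : ℝ} (hab : a ≤ b) :
    μ.real (Set.Ioc a b) = μ.real (Set.Iic b) - μ.real (Set.Iic a) := by
  have : Set.Ioc a b = Set.Iic b \ Set.Iic a := by
    ext x
    simp [and_comm]
  rw [this, measureReal_sdiff (Set.Iic_subset_Iic.mpr hab) measurableSet_Iic]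

/-- Turns closeness to the normal law into concentration: an interval is a difference of two
half-lines, each costing δ, and the Gaussian density is at most 1. This is how the bootstrap
hypothesis at Ψ enters. -/
lemma measureReal_Ioc_le_of_kolmogorov {ν : Measure ℝ} [IsFiniteMeasure ν] {δ : ℝ}
    (h : ∀ z, |ν.real (Set.Iic z) - (gaussianReal 0 1).real (Set.Iic z)| ≤ δ)
    {a b : ℝ} (hab : a ≤ b) : ν.real (Set.Ioc a b) ≤ (b - a) + 2 * δ := by
  have h1 := gaussianReal_real_Ioc_le hab
  rw [measureReal_Iic_sub hab] at h1 ⊢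
  have h2 := abs_le.mp (h a)
  have h3 := abs_le.mp (h b)
  linarith

/-- Smoothing: the Kolmogorov distance is controlled by smoothed indicators. -/
lemma abs_measureReal_Iic_sub_le {ν : Measure ℝ} [IsProbabilityMeasure ν] {ε B : ℝ} (hε : 0 < ε)
    (h : ∀ z, |∫ x, smoothInd z ε x ∂ν - ∫ x, smoothInd z ε x ∂(gaussianReal 0 1)| ≤ B) (z : ℝ) :
    |ν.real (Set.Iic z) - (gaussianReal 0 1).real (Set.Iic z)| ≤ B + ε := by
  have hint : ∀ (ρ : Measure ℝ) [IsProbabilityMeasure ρ] (z : ℝ),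
      Integrable (smoothInd z ε) ρ := fun ρ _ z =>
    Integrable.of_bound (continuous_smoothInd z ε).aestronglyMeasurable 1
      (.of_forall fun x => by
        rw [Real.norm_eq_abs, abs_of_nonneg (smoothInd_nonneg _ _ _)]
        exact smoothInd_le_one _ _ _)
  have hlow : ∀ (ρ : Measure ℝ) [IsProbabilityMeasure ρ] (z : ℝ),
      ρ.real (Set.Iic z) ≤ ∫ x, smoothInd z ε x ∂ρ := fun ρ _ z => by
    rw [← integral_indicator_one measurableSet_Iic]
    refine integral_mono ((integrable_const (1 : ℝ)).indicator measurableSet_Iic) (hint ρ z)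
      fun x => ?_
    by_cases hx : x ∈ Set.Iic z
    · rw [Set.indicator_of_mem hx, smoothInd_of_le hε hx]; rfl
    · rw [Set.indicator_of_notMem hx]; exact smoothInd_nonneg _ _ _
  have hup : ∀ (ρ : Measure ℝ) [IsProbabilityMeasure ρ] (z : ℝ),
      ∫ x, smoothInd z ε x ∂ρ ≤ ρ.real (Set.Iic (z + ε)) := fun ρ _ z => by
    rw [← integral_indicator_one measurableSet_Iic]
    refine integral_mono (hint ρ z) ((integrable_const (1 : ℝ)).indicator measurableSet_Iic)
      fun x => ?_
    by_cases hx : x ∈ Set.Iic (z + ε)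
    · rw [Set.indicator_of_mem hx]; exact smoothInd_le_one _ _ _
    · rw [Set.indicator_of_notMem hx, smoothInd_of_ge hε (not_le.mp hx).le]
  -- The indicator of (-∞, z] lies between the ramps starting at z - ε and at z. Passing from either
  -- ramp to the half-line on the Gaussian side costs the mass of an interval of length ε.
  have g1 := gaussianReal_real_Ioc_le (show z ≤ z + ε by linarith)
  have g2 := gaussianReal_real_Ioc_le (show z - ε ≤ z by linarith)
  rw [measureReal_Iic_sub (by linarith)] at g1 g2
  have a1 := hlow ν z
  have a2 := hup (gaussianReal 0 1) z
  have a3 := hlow (gaussianReal 0 1) (z - ε)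
  have a4 := hup ν (z - ε)
  rw [sub_add_cancel] at a4
  have b1 := abs_le.mp (h z)
  have b2 := abs_le.mp (h (z - ε))
  rw [abs_le]
  constructor <;> linarith

/-! ### Error terms of a Stein coupling -/

/-- Error bound for smoothed indicators in terms of a Stein coupling. -/
lemma IsSteinCoupling.smoothInd_error_le {Ω : Type*} [mΩ : MeasurableSpace Ω] {μ : Measure Ω}
    [IsProbabilityMeasure μ] {W W' G D : Ω → ℝ} (hc : IsSteinCoupling μ W W' G)
    (hW : Measurable W) (hW' : Measurable W') (hG : Measurable G)
    (hD : ∀ ω, W' ω - W ω = D ω) (hGD : Integrable (fun ω => G ω * D ω) μ)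
    {ε : ℝ} (hε : 0 < ε) (z : ℝ) :
    ENNReal.ofReal |∫ ω, smoothInd z ε (W ω) ∂μ - ∫ x, smoothInd z ε x ∂(gaussianReal 0 1)| ≤
      2 * posExp μ (fun ω => |(μ[fun ω' => 1 - G ω' * D ω' |
        MeasurableSpace.comap W inferInstance]) ω|) +
      8 * posExp μ (fun ω => (1 + |W ω|) * |G ω| * D ω ^ 2) +
      posExp μ (fun ω => |G ω| * |D ω| * min 1 (|D ω| / ε) *
        (Set.Ioc (z - ε - |D ω|) (z + ε + |D ω|)).indicator 1 (W ω)) := by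
  have hDm : Measurable D := by
    have : D = fun ω => W' ω - W ω := funext fun ω => (hD ω).symm
    rw [this]
    exact hW'.sub hW
  obtain ⟨f, hf, hb, hxb⟩ := exists_stein_solution (continuous_smoothInd z ε)
    (smoothInd_nonneg z ε) (smoothInd_le_one z ε)
  set N := ∫ x, smoothInd z ε x ∂(gaussianReal 0 1) with hN
  set f' : ℝ → ℝ := fun x => x * f x + (smoothInd z ε x - N) with hf'
  have hfc : Continuous f := continuous_iff_continuousAt.mpr fun x => (hf x).continuousAt
  have hfc' : Continuous f' := by
    have := continuous_smoothInd z ε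
    fun_prop
  have hsi : ∀ (ρ : Measure ℝ) [IsProbabilityMeasure ρ], Integrable (smoothInd z ε) ρ :=
    fun ρ _ => Integrable.of_bound (continuous_smoothInd z ε).aestronglyMeasurable 1
      (.of_forall fun x => by
        rw [Real.norm_eq_abs, abs_of_nonneg (smoothInd_nonneg _ _ _)]
        exact smoothInd_le_one _ _ _)
  have hN0 : 0 ≤ N := integral_nonneg (smoothInd_nonneg z ε)
  have hN1 : N ≤ 1 := by
    calc N ≤ ∫ y, (1 : ℝ) ∂(gaussianReal 0 1) :=
          integral_mono (hsi _) (integrable_const _) (smoothInd_le_one z ε)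
      _ = 1 := by simp
  have hb' : ∀ x, |f' x| ≤ 2 := fun x => by
    have h1 := abs_le.mp (hxb x)
    have h2 := smoothInd_nonneg z ε x
    have h3 := smoothInd_le_one z ε x
    rw [abs_le]
    constructor <;> simp only [hf'] <;> linarith
  have hrem := abs_stein_remainder_le hε hf (fun x => rfl) hb hb'
  have hlip : ∀ x y, |f y - f x| ≤ 2 * |y - x| := fun x y =>
    convex_univ.norm_image_sub_le_of_norm_hasDerivWithin_le
      (fun u _ => (hf u).hasDerivWithinAt) (fun u _ => hb' u) (Set.mem_univ _) (Set.mem_univ _)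
  -- G alone need not be integrable; the Lipschitz bound on f controls the difference by 2|GD|.
  have i1 : Integrable (fun ω => G ω * f (W' ω) - G ω * f (W ω)) μ := by
    refine (hGD.norm.const_mul 2).mono'
      ((hG.mul (hfc.measurable.comp hW')).sub
        (hG.mul (hfc.measurable.comp hW))).aestronglyMeasurable (.of_forall fun ω => ?_)
    rw [← mul_sub, norm_mul, norm_mul, ← hD]
    have := hlip (W ω) (W' ω)
    simp only [Real.norm_eq_abs]
    nlinarith [abs_nonneg (G ω)]
  have i2 : Integrable (fun ω => W ω * f (W ω)) μ :=
    Integrable.of_bound (hW.mul (hfc.measurable.comp hW)).aestronglyMeasurable 1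
      (.of_forall fun ω => hxb _)
  have i3 : Integrable (fun ω => f' (W ω)) μ :=
    Integrable.of_bound (hfc'.measurable.comp hW).aestronglyMeasurable 2
      (.of_forall fun ω => hb' _)
  have i4 : Integrable (fun ω => smoothInd z ε (W ω)) μ :=
    Integrable.of_bound ((continuous_smoothInd z ε).measurable.comp hW).aestronglyMeasurable 1
      (.of_forall fun ω => by
        rw [Real.norm_eq_abs, abs_of_nonneg (smoothInd_nonneg _ _ _)]
        exact smoothInd_le_one _ _ _)
  have i5 : Integrable (fun ω => 1 - G ω * D ω) μ := (integrable_const 1).sub hGD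
  have i6 : Integrable (fun ω => f' (W ω) * (1 - G ω * D ω)) μ :=
    i5.bdd_mul i3.aestronglyMeasurable (.of_forall fun ω => hb' (W ω))
  have i8 : Integrable (fun ω => smoothInd z ε (W ω) - N) μ := i4.sub (integrable_const _)
  have i9 : Integrable (fun ω => f' (W ω) - f' (W ω) * (1 - G ω * D ω)) μ := i3.sub i6
  have hst := hc f hfc.measurable i1 i2
  set R : Ω → ℝ := fun ω => f (W ω + D ω) - f (W ω) - D ω * f' (W ω) with hR
  have hGR : (fun ω => G ω * R ω) = fun ω =>
      (G ω * f (W' ω) - G ω * f (W ω)) - (f' (W ω) - f' (W ω) * (1 - G ω * D ω)) := by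
    ext ω
    have : W ω + D ω = W' ω := by rw [← hD]; ring
    simp only [hR, this]
    ring
  have i7 : Integrable (fun ω => G ω * R ω) μ := by
    rw [hGR]
    exact i1.sub i9
  have main : ∫ ω, smoothInd z ε (W ω) ∂μ - N =
      ∫ ω, f' (W ω) * (1 - G ω * D ω) ∂μ - ∫ ω, G ω * R ω ∂μ := by
    have e1 : ∫ ω, f' (W ω) ∂μ = ∫ ω, W ω * f (W ω) ∂μ +
        (∫ ω, smoothInd z ε (W ω) ∂μ - N) := by
      have : (fun ω => f' (W ω)) = fun ω => W ω * f (W ω) + (smoothInd z ε (W ω) - N) := rfl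
      rw [this, integral_add i2 i8, integral_sub i4 (integrable_const _)]
      simp
    rw [hGR, integral_sub i1 i9, integral_sub i3 i6, hst, e1]
    ring
  have hmle : MeasurableSpace.comap W inferInstance ≤ mΩ := hW.comap_le
  have hfW : StronglyMeasurable[MeasurableSpace.comap W inferInstance] (fun ω => f' (W ω)) :=
    (hfc'.measurable.comp (comap_measurable W)).stronglyMeasurable
  -- As f'(W) is a function of W, 1 - GD may be replaced by its conditional expectation before
  -- absolute values are taken.
  have cond : ∫ ω, f' (W ω) * (1 - G ω * D ω) ∂μ =
      ∫ ω, f' (W ω) * (μ[fun ω' => 1 - G ω' * D ω' |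
        MeasurableSpace.comap W inferInstance]) ω ∂μ := by
    rw [← integral_condExp hmle]
    exact integral_congr_ae (condExp_mul_of_stronglyMeasurable_left hfW i6 i5)
  have b1 : ENNReal.ofReal |∫ ω, f' (W ω) * (1 - G ω * D ω) ∂μ| ≤
      2 * posExp μ (fun ω => |(μ[fun ω' => 1 - G ω' * D ω' |
        MeasurableSpace.comap W inferInstance]) ω|) := by
    rw [cond, ← Real.enorm_eq_ofReal_abs]
    refine (enorm_integral_le_lintegral_enorm _).trans ?_
    unfold posExp
    rw [← lintegral_const_mul' _ _ (by norm_num)]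
    refine lintegral_mono fun ω => ?_
    rw [Real.enorm_eq_ofReal_abs, abs_mul, ENNReal.ofReal_mul (abs_nonneg _)]
    gcongr
    exact ENNReal.ofReal_le_of_le_toReal (by simpa using hb' (W ω))
  have b2 : ENNReal.ofReal |∫ ω, G ω * R ω ∂μ| ≤
      8 * posExp μ (fun ω => (1 + |W ω|) * |G ω| * D ω ^ 2) +
      posExp μ (fun ω => |G ω| * |D ω| * min 1 (|D ω| / ε) *
        (Set.Ioc (z - ε - |D ω|) (z + ε + |D ω|)).indicator 1 (W ω)) := by
    rw [← Real.enorm_eq_ofReal_abs]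
    refine (enorm_integral_le_lintegral_enorm _).trans ?_
    unfold posExp
    rw [← lintegral_const_mul' _ _ (by norm_num), ← lintegral_add_left]
    swap
    · fun_prop
    refine lintegral_mono fun ω => ?_
    have h8 : (8 : ℝ≥0∞) = ENNReal.ofReal 8 := by simp
    have hind : (0 : ℝ) ≤ (Set.Ioc (z - ε - |D ω|) (z + ε + |D ω|)).indicator 1 (W ω) :=
      Set.indicator_nonneg (fun _ _ => zero_le_one) _
    rw [Real.enorm_eq_ofReal_abs, h8, ← ENNReal.ofReal_mul (by norm_num),
      ← ENNReal.ofReal_add (by positivity) (by positivity)]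
    refine ENNReal.ofReal_le_ofReal ?_
    rw [abs_mul]
    refine (mul_le_mul_of_nonneg_left (hrem (W ω) (D ω)) (abs_nonneg _)).trans (le_of_eq ?_)
    ring
  rw [main, add_assoc]
  refine (ENNReal.ofReal_le_ofReal (abs_sub _ _)).trans ?_
  rw [ENNReal.ofReal_add (abs_nonneg _) (abs_nonneg _)]
  exact add_le_add b1 b2

/-- Concentration estimate: the conditional law of `V` is used to integrate out an interval whose
end points depend on the conditioning variables. -/
lemma lintegral_indicator_Ioc_le {Θ Ω : Type*} [MeasurableSpace Θ] [MeasurableSpace Ω]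
    {ν : Measure Ω} [IsFiniteMeasure ν] {G D B V : Ω → ℝ} {Ψ : Ω → Θ}
    (hG : Measurable G) (hD : Measurable D) (hB : Measurable B) (hV : Measurable V)
    (hΨ : Measurable Ψ) (κ : Kernel Θ ℝ) [IsMarkovKernel κ]
    (hrect : ∀ S : Set (ℝ × ℝ × ℝ × Θ), MeasurableSet S → ∀ A : Set ℝ, MeasurableSet A →
      ν ((fun ω => (G ω, D ω, B ω, Ψ ω)) ⁻¹' S ∩ V ⁻¹' A) =
        ∫⁻ ω in (fun ω => (G ω, D ω, B ω, Ψ ω)) ⁻¹' S, κ (Ψ ω) A ∂ν)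
    {m σ s L ε z : ℝ} (hs : 0 ≤ s) (hL : 0 ≤ L) (hε : 0 < ε)
    (hκ : ∀ᵐ ω ∂ν, ∀ u v, u ≤ v →
      (κ (Ψ ω)).real (Set.Ioc (m + σ * u) (m + σ * v)) ≤ s * (v - u) + L) :
    ∫⁻ ω, ENNReal.ofReal (max (G ω) 0 * |D ω| * min 1 (|D ω| / ε) *
        (Set.Ioc (m + σ * (z - ε - |D ω| - max (B ω) 0))
          (m + σ * (z + ε + |D ω| + max (B ω) 0))).indicator 1 (V ω)) ∂ν ≤
      ENNReal.ofReal (4 * s + L / ε) * posExp ν (fun ω => G ω * D ω ^ 2) +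
        ENNReal.ofReal (2 * s / ε) * posExp ν (fun ω => G ω * D ω ^ 2 * B ω) := by
  set X : Ω → ℝ × ℝ × ℝ × Θ := fun ω => (G ω, D ω, B ω, Ψ ω) with hX
  have hXm : Measurable X := by fun_prop
  set T : Set ((ℝ × ℝ × ℝ × Θ) × ℝ) := {p | m + σ * (z - ε - |p.1.2.1| - max p.1.2.2.1 0) < p.2 ∧
    p.2 ≤ m + σ * (z + ε + |p.1.2.1| + max p.1.2.2.1 0)} with hT
  set g : (ℝ × ℝ × ℝ × Θ) × ℝ → ℝ≥0∞ := T.indicator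
    (fun p => ENNReal.ofReal (max p.1.1 0 * |p.1.2.1| * min 1 (|p.1.2.1| / ε))) with hg
  have hgm : Measurable g := by
    have m1 : Measurable fun p : (ℝ × ℝ × ℝ × Θ) × ℝ =>
      m + σ * (z - ε - |p.1.2.1| - max p.1.2.2.1 0) := by fun_prop
    have m2 : Measurable fun p : (ℝ × ℝ × ℝ × Θ) × ℝ =>
      m + σ * (z + ε + |p.1.2.1| + max p.1.2.2.1 0) := by fun_prop
    exact Measurable.indicator (by fun_prop)
      ((measurableSet_lt m1 measurable_snd).inter (measurableSet_le measurable_snd m2))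
  -- Given the conditioning variables X, the end points are fixed, and only V is integrated, against
  -- κ at Ψ.
  have hdis := lintegral_eq_lintegral_kernel hXm hV
    (κ.comap (fun x : ℝ × ℝ × ℝ × Θ => x.2.2.2) (by fun_prop)) (fun S hS A hA => by
      simpa only [Kernel.comap_apply] using hrect S hS A hA) hgm
  have hlhs : ∀ ω, ENNReal.ofReal (max (G ω) 0 * |D ω| * min 1 (|D ω| / ε) *
        (Set.Ioc (m + σ * (z - ε - |D ω| - max (B ω) 0))
          (m + σ * (z + ε + |D ω| + max (B ω) 0))).indicator 1 (V ω)) = g (X ω, V ω) := by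
    intro ω
    by_cases hω : V ω ∈ Set.Ioc (m + σ * (z - ε - |D ω| - max (B ω) 0))
          (m + σ * (z + ε + |D ω| + max (B ω) 0))
    · have hω' : (X ω, V ω) ∈ T := hω
      rw [Set.indicator_of_mem hω, hg, Set.indicator_of_mem hω', Pi.one_apply, mul_one]
    · have hω' : (X ω, V ω) ∉ T := hω
      rw [Set.indicator_of_notMem hω, hg, Set.indicator_of_notMem hω', mul_zero,
        ENNReal.ofReal_zero]
  simp only [hlhs]
  rw [hdis]
  unfold posExp
  rw [← lintegral_const_mul' _ _ ENNReal.ofReal_ne_top,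
    ← lintegral_const_mul' _ _ ENNReal.ofReal_ne_top, ← lintegral_add_left (by fun_prop)]
  refine lintegral_mono_ae ?_
  filter_upwards [hκ] with ω hω
  set d := |D ω| with hd
  set b := max (B ω) 0 with hb
  have hd0 : 0 ≤ d := abs_nonneg _
  have hb0 : 0 ≤ b := le_max_right _ _
  have hG0 : 0 ≤ max (G ω) 0 := le_max_right _ _
  set I := Set.Ioc (m + σ * (z - ε - d - b)) (m + σ * (z + ε + d + b)) with hI
  have e1 : ∫⁻ y, g (X ω, y) ∂(κ.comap (fun x : ℝ × ℝ × ℝ × Θ => x.2.2.2) (by fun_prop)) (X ω) =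
      ENNReal.ofReal (max (G ω) 0 * d * min 1 (d / ε)) * κ (Ψ ω) I := by
    rw [Kernel.comap_apply, ← setLIntegral_const, ← lintegral_indicator measurableSet_Ioc]
    refine lintegral_congr fun y => ?_
    simp only [hg, Set.indicator_apply]
    rfl
  have hk := hω (z - ε - d - b) (z + ε + d + b) (by linarith)
  have e2 : κ (Ψ ω) I ≤ ENNReal.ofReal (s * (2 * ε + 2 * d + 2 * b) + L) := by
    rw [← ofReal_measureReal]
    refine ENNReal.ofReal_le_ofReal (hk.trans (le_of_eq ?_))
    ring
  -- The bound 1 for the minimum is used against the length 2d, which avoids a cubic term in d; the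
  -- bound d/ε is used against the rest, where it cancels the length 2ε.
  have hmin : d * min 1 (d / ε) * (s * (2 * ε + 2 * d + 2 * b) + L) ≤
      (4 * s + L / ε) * d ^ 2 + 2 * s / ε * (d ^ 2 * b) := by
    have hm1 : min 1 (d / ε) ≤ 1 := min_le_left _ _
    have hm2 : min 1 (d / ε) ≤ d / ε := min_le_right _ _
    have t1 : d * min 1 (d / ε) * (2 * s * d) ≤ 2 * s * d ^ 2 := by
      have : 0 ≤ d * (s * d) := by positivity
      nlinarith
    have t2 : d * min 1 (d / ε) * (2 * s * ε + 2 * s * b + L) ≤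
        d * (d / ε) * (2 * s * ε + 2 * s * b + L) := by
      gcongr
    have t3 : d * (d / ε) * (2 * s * ε + 2 * s * b + L) =
        2 * s * d ^ 2 + L / ε * d ^ 2 + 2 * s / ε * (d ^ 2 * b) := by
      field_simp
      ring
    linarith
  have f1 : ENNReal.ofReal (G ω * D ω ^ 2) = ENNReal.ofReal (max (G ω) 0 * d ^ 2) := by
    rw [hd, sq_abs]
    rcases le_total (G ω) 0 with h | h
    · rw [max_eq_right h, zero_mul, ENNReal.ofReal_zero,
        ENNReal.ofReal_of_nonpos (mul_nonpos_of_nonpos_of_nonneg h (sq_nonneg _))]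
    · rw [max_eq_left h]
  have f2 : ENNReal.ofReal (max (G ω) 0 * (d ^ 2 * b)) ≤ ENNReal.ofReal (G ω * D ω ^ 2 * B ω) := by
    rw [hd, sq_abs, hb]
    rcases le_total (G ω) 0 with h | h
    · simp [max_eq_right h]
    · rcases le_total (B ω) 0 with h' | h'
      · simp [max_eq_right h']
      · rw [max_eq_left h, max_eq_left h', mul_assoc]
  rw [e1, f1]
  calc _ ≤ ENNReal.ofReal (max (G ω) 0 * d * min 1 (d / ε)) *
          ENNReal.ofReal (s * (2 * ε + 2 * d + 2 * b) + L) := by gcongr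
    _ = ENNReal.ofReal (max (G ω) 0 * (d * min 1 (d / ε) * (s * (2 * ε + 2 * d + 2 * b) + L))) := by
        rw [← ENNReal.ofReal_mul (by positivity)]
        congr 1
        ring
    _ ≤ ENNReal.ofReal ((4 * s + L / ε) * (max (G ω) 0 * d ^ 2) +
          2 * s / ε * (max (G ω) 0 * (d ^ 2 * b))) := by
        refine ENNReal.ofReal_le_ofReal ?_
        refine (mul_le_mul_of_nonneg_left hmin hG0).trans (le_of_eq ?_)
        ring
    _ = ENNReal.ofReal (4 * s + L / ε) * ENNReal.ofReal (max (G ω) 0 * d ^ 2) +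
          ENNReal.ofReal (2 * s / ε) * ENNReal.ofReal (max (G ω) 0 * (d ^ 2 * b)) := by
        rw [ENNReal.ofReal_add (by positivity) (by positivity),
          ENNReal.ofReal_mul (p := 4 * s + L / ε) (by positivity),
          ENNReal.ofReal_mul (p := 2 * s / ε) (by positivity)]
    _ ≤ _ := by gcongr

/-- The error term of the Stein coupling is controlled by the majorants of `G`, `D` and `Y - V`. -/
lemma posExp_indicator_le {Ω : Type*} [MeasurableSpace Ω] {μ : Measure Ω}
    {W Y V G D Gbar Dbar Bbar : Ω → ℝ} {F₁ F₂ : Set Ω} {m σ ε z : ℝ} (hσ : 0 < σ) (hε : 0 < ε)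
    (hF₁ : MeasurableSet F₁) (hF₂ : MeasurableSet F₂)
    (hYW : ∀ ω, Y ω = m + σ * W ω)
    (hGbar : ∀ᵐ ω ∂μ, ω ∈ F₁ → |G ω| ≤ Gbar ω) (hDbar : ∀ᵐ ω ∂μ, ω ∈ F₁ → |D ω| ≤ Dbar ω)
    (hBbar : ∀ᵐ ω ∂μ, ω ∈ F₁ → σ⁻¹ * |Y ω - V ω| ≤ Bbar ω) :
    posExp μ (fun ω => |G ω| * |D ω| * min 1 (|D ω| / ε) *
        (Set.Ioc (z - ε - |D ω|) (z + ε + |D ω|)).indicator 1 (W ω)) ≤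
      ENNReal.ofReal (1 / ε) * posExp (μ.restrict F₁ᶜ) (fun ω => |G ω| * D ω ^ 2) +
      ENNReal.ofReal (1 / ε) * posExp (μ.restrict F₂ᶜ) (fun ω => |G ω| * D ω ^ 2) +
      ∫⁻ ω in F₂, ENNReal.ofReal (max (Gbar ω) 0 * |Dbar ω| * min 1 (|Dbar ω| / ε) *
        (Set.Ioc (m + σ * (z - ε - |Dbar ω| - max (Bbar ω) 0))
          (m + σ * (z + ε + |Dbar ω| + max (Bbar ω) 0))).indicator 1 (V ω)) ∂μ := by
  set g : Ω → ℝ≥0∞ := fun ω => ENNReal.ofReal (|G ω| * |D ω| * min 1 (|D ω| / ε) *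
        (Set.Ioc (z - ε - |D ω|) (z + ε + |D ω|)).indicator 1 (W ω)) with hg
  -- On the exceptional sets the interval is ignored. The factor 1/ε, later of order r, is why the
  -- moments there carry the weight r².
  have hout : ∀ S : Set Ω, ∫⁻ ω in S, g ω ∂μ ≤
      ENNReal.ofReal (1 / ε) * posExp (μ.restrict S) (fun ω => |G ω| * D ω ^ 2) := by
    intro S
    unfold posExp
    rw [← lintegral_const_mul' _ _ ENNReal.ofReal_ne_top]
    refine lintegral_mono fun ω => ?_
    rw [← ENNReal.ofReal_mul (by positivity)]
    refine ENNReal.ofReal_le_ofReal ?_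
    have hind : (Set.Ioc (z - ε - |D ω|) (z + ε + |D ω|)).indicator (1 : ℝ → ℝ) (W ω) ≤ 1 :=
      Set.indicator_le_self' (fun _ _ => zero_le_one) _
    have hind0 : 0 ≤ (Set.Ioc (z - ε - |D ω|) (z + ε + |D ω|)).indicator (1 : ℝ → ℝ) (W ω) :=
      Set.indicator_nonneg (fun _ _ => zero_le_one) _
    have hmin : min 1 (|D ω| / ε) ≤ |D ω| / ε := min_le_right _ _
    calc _ ≤ |G ω| * |D ω| * (|D ω| / ε) * 1 := by gcongr
      _ = 1 / ε * (|G ω| * D ω ^ 2) := by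
          rw [← sq_abs (D ω)]
          ring
  have hin : ∫⁻ ω in F₁ ∩ F₂, g ω ∂μ ≤ ∫⁻ ω in F₁ ∩ F₂,
      ENNReal.ofReal (max (Gbar ω) 0 * |Dbar ω| * min 1 (|Dbar ω| / ε) *
        (Set.Ioc (m + σ * (z - ε - |Dbar ω| - max (Bbar ω) 0))
          (m + σ * (z + ε + |Dbar ω| + max (Bbar ω) 0))).indicator 1 (V ω)) ∂μ := by
    refine lintegral_mono_ae ?_
    rw [ae_restrict_iff' (hF₁.inter hF₂)]
    filter_upwards [hGbar, hDbar, hBbar] with ω h1 h2 h3 hω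
    have h1 := (h1 hω.1).trans (le_max_left _ 0)
    have h2 := (h2 hω.1).trans (le_abs_self _)
    have h3 := (h3 hω.1).trans (le_max_left _ 0)
    refine ENNReal.ofReal_le_ofReal ?_
    by_cases hmem : W ω ∈ Set.Ioc (z - ε - |D ω|) (z + ε + |D ω|)
    · have hVmem : V ω ∈ Set.Ioc (m + σ * (z - ε - |Dbar ω| - max (Bbar ω) 0))
          (m + σ * (z + ε + |Dbar ω| + max (Bbar ω) 0)) := by
        -- In the units of Y, the distance from V to Y is at most σ times the majorant, so the
        -- interval for V is widened by exactly this amount.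
        have h4 : |Y ω - V ω| ≤ σ * max (Bbar ω) 0 := by
          rwa [inv_mul_le_iff₀ hσ] at h3
        have h5 := abs_le.mp h4
        have h6 := hYW ω
        have h7 := mul_lt_mul_of_pos_left hmem.1 hσ
        have h8 := mul_le_mul_of_nonneg_left hmem.2 hσ.le
        have h9 := mul_le_mul_of_nonneg_left h2 hσ.le
        constructor <;> nlinarith
      rw [Set.indicator_of_mem hmem, Set.indicator_of_mem hVmem]
      simp only [Pi.one_apply, mul_one]
      gcongr
    · rw [Set.indicator_of_notMem hmem, mul_zero]
      exact mul_nonneg (by positivity) (Set.indicator_nonneg (fun _ _ => zero_le_one) _)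
  have huniv : (Set.univ : Set Ω) = (F₁ᶜ ∪ F₂ᶜ) ∪ (F₁ ∩ F₂) := by
    rw [← Set.compl_inter, Set.compl_union_self]
  calc posExp μ _ = ∫⁻ ω in (F₁ᶜ ∪ F₂ᶜ) ∪ (F₁ ∩ F₂), g ω ∂μ := by
        rw [← huniv, setLIntegral_univ]; rfl
    _ ≤ ∫⁻ ω in F₁ᶜ, g ω ∂μ + ∫⁻ ω in F₂ᶜ, g ω ∂μ + ∫⁻ ω in F₁ ∩ F₂, g ω ∂μ :=
        (lintegral_union_le _ _ _).trans (add_le_add_left (lintegral_union_le _ _ _) _)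
    -- F₁ need not belong to the conditioning σ-algebra. Once only majorants and V remain, the
    -- nonnegative integrand may be extended from F₁ ∩ F₂ to F₂.
    _ ≤ _ := add_le_add (add_le_add (hout _) (hout _))
        (hin.trans (lintegral_mono_set Set.inter_subset_right))

/-! ### Uniform constants and the bootstrap principle -/

lemma exists_bound_of_iSup_mul_lt_top {Θ : Type*} {S : Set Θ} {c : Θ → ℝ}
    (hc : ∀ θ ∈ S, 0 < c θ) {X : Θ → ℝ≥0∞} (h : ⨆ θ ∈ S, ENNReal.ofReal (c θ) * X θ < ∞) :
    ∃ C : ℝ, 0 ≤ C ∧ ∀ θ ∈ S, X θ ≤ ENNReal.ofReal (C / c θ) := by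
  refine ⟨(⨆ θ ∈ S, ENNReal.ofReal (c θ) * X θ).toReal, ENNReal.toReal_nonneg, fun θ hθ => ?_⟩
  rw [ENNReal.ofReal_div_of_pos (hc θ hθ), ENNReal.ofReal_toReal h.ne,
    ENNReal.le_div_iff_mul_le (.inl (by simpa using hc θ hθ)) (.inl ENNReal.ofReal_ne_top),
    mul_comm]
  exact le_iSup₂ (f := fun θ (_ : θ ∈ S) => ENNReal.ofReal (c θ) * X θ) θ hθ

lemma exists_bound_of_iSup_essSupOn_lt_top {Θ Ω : Type*} [MeasurableSpace Ω] {S : Set Θ}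
    {μ : Θ → Measure Ω} {T : Θ → Set Ω} (hT : ∀ θ ∈ S, MeasurableSet (T θ)) {X : Θ → Ω → ℝ}
    (h : ⨆ θ ∈ S, essSupOn (μ θ) (T θ) (X θ) < ∞) :
    ∃ C : ℝ, 0 ≤ C ∧ ∀ θ ∈ S, ∀ᵐ ω ∂(μ θ), ω ∈ T θ → X θ ω ≤ C := by
  refine ⟨(⨆ θ ∈ S, essSupOn (μ θ) (T θ) (X θ)).toReal, ENNReal.toReal_nonneg, fun θ hθ => ?_⟩
  rw [← ae_restrict_iff' (hT θ hθ)]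
  filter_upwards [ENNReal.ae_le_essSup (μ := (μ θ).restrict (T θ))
    fun ω => ENNReal.ofReal (X θ ω)] with ω hω
  exact (ENNReal.ofReal_le_iff_le_toReal h.ne).mp (hω.trans
    (le_iSup₂ (f := fun θ (_ : θ ∈ S) => essSupOn (μ θ) (T θ) (X θ)) θ hθ))

/-- Bootstrap: a self-improving bound on a weighted family, valid for every truncation level of the
weights, yields a uniform bound. -/
lemma mul_le_of_self_improving {Θ ι : Type*} {r : Θ → ℝ} (hr : ∀ θ, 0 < r θ) {δ : Θ → ι → ℝ}
    (h0 : ∀ θ i, 0 ≤ δ θ i) (h1 : ∀ θ i, δ θ i ≤ 1) {C : ℝ}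
    (hstep : ∀ n > 0, ∀ K ≥ 0, (∀ θ i, min (r θ) n * δ θ i ≤ K) →
      ∀ θ i, min (r θ) n * δ θ i ≤ C + K / 2) (θ : Θ) (i : ι) : r θ * δ θ i ≤ 2 * C := by
  -- Truncating at n = r θ makes the supremum finite, since δ ≤ 1, yet changes nothing at θ itself.
  have hb : BddAbove (Set.range fun p : Θ × ι => min (r p.1) (r θ) * δ p.1 p.2) := by
    refine ⟨r θ, ?_⟩
    rintro _ ⟨p, rfl⟩
    exact (mul_le_mul (min_le_right _ _) (h1 _ _) (h0 _ _) (hr θ).le).trans (mul_one _).le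
  set K := ⨆ p : Θ × ι, min (r p.1) (r θ) * δ p.1 p.2 with hK
  have hle : ∀ θ' i', min (r θ') (r θ) * δ θ' i' ≤ K := fun θ' i' => le_ciSup hb (θ', i')
  have hmain : r θ * δ θ i ≤ K := by simpa using hle θ i
  have hK0 : 0 ≤ K := (mul_nonneg (hr θ).le (h0 θ i)).trans hmain
  have : Nonempty (Θ × ι) := ⟨(θ, i)⟩
  have hK2 : K ≤ C + K / 2 :=
    ciSup_le fun p => hstep (r θ) (hr θ) K hK0 hle p.1 p.2
  linarith

/-! ### Standardization and change of scale -/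

lemma measurable_standardize {Θ Ω : Type*} [MeasurableSpace Θ] [MeasurableSpace Ω]
    (P : Kernel Θ Ω) {Y : Θ → Ω → ℝ} {θ : Θ} (hY : Measurable (Y θ)) :
    Measurable (standardize P Y θ) := by
  unfold standardize
  split_ifs
  · exact (hY.sub_const _).div_const _
  · exact measurable_const

lemma eq_add_mul_standardize {Θ Ω : Type*} [MeasurableSpace Θ] [MeasurableSpace Ω]
    (P : Kernel Θ Ω) (Y : Θ → Ω → ℝ) {θ : Θ} (h : 0 < Var[Y θ; P θ]) (ω : Ω) :
    Y θ ω = ∫ ω', Y θ ω' ∂(P θ) + √Var[Y θ; P θ] * standardize P Y θ ω := by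
  have := Real.sqrt_pos.mpr h
  rw [standardize, if_pos h]
  field_simp
  ring

/-- Concentration of an affine image of a variable that is close to normal. -/
lemma map_real_Ioc_le {Ω : Type*} [MeasurableSpace Ω] {μ : Measure Ω} [IsProbabilityMeasure μ]
    {Y W : Ω → ℝ} (hY : Measurable Y) (hW : Measurable W) {m' σ' : ℝ} (hσ' : 0 < σ')
    (hYW : ∀ ω, Y ω = m' + σ' * W ω) {δ : ℝ}
    (hδ : ∀ z, |(μ.map W).real (Set.Iic z) - (gaussianReal 0 1).real (Set.Iic z)| ≤ δ)
    {m σ s : ℝ} (hσ : 0 ≤ σ) (hs : σ / σ' ≤ s) {u v : ℝ} (huv : u ≤ v) :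
    (μ.map Y).real (Set.Ioc (m + σ * u) (m + σ * v)) ≤ s * (v - u) + 2 * δ := by
  have e : (μ.map Y).real (Set.Ioc (m + σ * u) (m + σ * v)) =
      (μ.map W).real (Set.Ioc ((m + σ * u - m') / σ') ((m + σ * v - m') / σ')) := by
    rw [map_measureReal_apply hY measurableSet_Ioc, map_measureReal_apply hW measurableSet_Ioc]
    congr 1
    ext ω
    simp only [Set.mem_preimage, Set.mem_Ioc, hYW, div_lt_iff₀ hσ', le_div_iff₀ hσ']
    constructor <;> rintro ⟨h1, h2⟩ <;> constructor <;> linarith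
  have : IsProbabilityMeasure (μ.map W) := Measure.isProbabilityMeasure_map hW.aemeasurable
  have hle : m + σ * u - m' ≤ m + σ * v - m' := by
    have := mul_le_mul_of_nonneg_left huv hσ
    linarith
  rw [e]
  refine (measureReal_Ioc_le_of_kolmogorov hδ (by gcongr)).trans ?_
  have e2 : (m + σ * v - m') / σ' - (m + σ * u - m') / σ' = σ / σ' * (v - u) := by
    field_simp
    ring
  rw [e2]
  have := mul_le_mul_of_nonneg_right hs (sub_nonneg.mpr huv)
  linarith

/-! ### One bootstrap step -/

/-- Kolmogorov bound for a Stein coupling, given concentration of the conditional law. -/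
lemma IsSteinCoupling.kolmogorov_le {Θ Ω : Type*} [MeasurableSpace Θ] [MeasurableSpace Ω]
    {μ : Measure Ω} [IsProbabilityMeasure μ] {W W' Y V G D Gbar Dbar Bbar : Ω → ℝ} {Ψ : Ω → Θ}
    (hc : IsSteinCoupling μ W W' G) (hW : Measurable W) (hW' : Measurable W') (hG : Measurable G)
    (hD : ∀ ω, W' ω - W ω = D ω) (hGD : Integrable (fun ω => G ω * D ω) μ)
    (hGm : Measurable Gbar) (hDm : Measurable Dbar) (hBm : Measurable Bbar) (hV : Measurable V)
    (hΨ : Measurable Ψ) (κ : Kernel Θ ℝ) [IsMarkovKernel κ] {F₁ F₂ : Set Ω}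
    (hF₁ : MeasurableSet F₁) (hF₂ : MeasurableSet F₂)
    (hrect : ∀ S : Set (ℝ × ℝ × ℝ × Θ), MeasurableSet S → ∀ A : Set ℝ, MeasurableSet A →
      (μ.restrict F₂) ((fun ω => (Gbar ω, Dbar ω, Bbar ω, Ψ ω)) ⁻¹' S ∩ V ⁻¹' A) =
        ∫⁻ ω in (fun ω => (Gbar ω, Dbar ω, Bbar ω, Ψ ω)) ⁻¹' S, κ (Ψ ω) A ∂(μ.restrict F₂))
    {m σ s L ε : ℝ} (hσ : 0 < σ) (hs : 0 ≤ s) (hL : 0 ≤ L) (hε : 0 < ε)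
    (hYW : ∀ ω, Y ω = m + σ * W ω)
    (hκ : ∀ᵐ ω ∂μ, ω ∈ F₂ → ∀ u v, u ≤ v →
      (κ (Ψ ω)).real (Set.Ioc (m + σ * u) (m + σ * v)) ≤ s * (v - u) + L)
    (hGbar : ∀ᵐ ω ∂μ, ω ∈ F₁ → |G ω| ≤ Gbar ω) (hDbar : ∀ᵐ ω ∂μ, ω ∈ F₁ → |D ω| ≤ Dbar ω)
    (hBbar : ∀ᵐ ω ∂μ, ω ∈ F₁ → σ⁻¹ * |Y ω - V ω| ≤ Bbar ω)
    {a₁ a₂ a₃ a₄ a₅ a₆ : ℝ} (ha₁ : 0 ≤ a₁) (ha₂ : 0 ≤ a₂) (ha₃ : 0 ≤ a₃) (ha₄ : 0 ≤ a₄)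
    (ha₅ : 0 ≤ a₅) (ha₆ : 0 ≤ a₆)
    (h₁ : posExp μ (fun ω => |(μ[fun ω' => 1 - G ω' * D ω' |
        MeasurableSpace.comap W inferInstance]) ω|) ≤ ENNReal.ofReal a₁)
    (h₂ : posExp μ (fun ω => (1 + |W ω|) * |G ω| * D ω ^ 2) ≤ ENNReal.ofReal a₂)
    (h₃ : posExp (μ.restrict F₁ᶜ) (fun ω => |G ω| * D ω ^ 2) ≤ ENNReal.ofReal a₃)
    (h₄ : posExp (μ.restrict F₂ᶜ) (fun ω => |G ω| * D ω ^ 2) ≤ ENNReal.ofReal a₄)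
    (h₅ : posExp μ (fun ω => Gbar ω * Dbar ω ^ 2) ≤ ENNReal.ofReal a₅)
    (h₆ : posExp (μ.restrict F₂) (fun ω => Gbar ω * Dbar ω ^ 2 * Bbar ω) ≤ ENNReal.ofReal a₆)
    (z : ℝ) :
    |(μ.map W).real (Set.Iic z) - (gaussianReal 0 1).real (Set.Iic z)| ≤
      2 * a₁ + 8 * a₂ + (a₃ + a₄) / ε + (4 * s + L / ε) * a₅ + 2 * s / ε * a₆ + ε := by
  have : IsProbabilityMeasure (μ.map W) := Measure.isProbabilityMeasure_map hW.aemeasurable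
  refine abs_measureReal_Iic_sub_le hε (fun z => ?_) z
  rw [integral_map hW.aemeasurable (continuous_smoothInd z ε).aestronglyMeasurable]
  have b1 := hc.smoothInd_error_le hW hW' hG hD hGD hε z
  have b2 := posExp_indicator_le (z := z) hσ hε hF₁ hF₂ hYW hGbar hDbar hBbar
  have b3 := lintegral_indicator_Ioc_le (z := z) hGm hDm hBm hV hΨ κ hrect hs hL hε
    ((ae_restrict_iff' hF₂).mpr hκ)
  have b5 : posExp (μ.restrict F₂) (fun ω => Gbar ω * Dbar ω ^ 2) ≤ ENNReal.ofReal a₅ :=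
    (lintegral_mono' Measure.restrict_le_self le_rfl).trans h₅
  refine (ENNReal.ofReal_le_ofReal_iff (by positivity)).mp ?_
  have c8 : (8 : ℝ≥0∞) = ENNReal.ofReal 8 := by simp
  have c2 : (2 : ℝ≥0∞) = ENNReal.ofReal 2 := by simp
  calc _ ≤ ENNReal.ofReal 2 * ENNReal.ofReal a₁ + ENNReal.ofReal 8 * ENNReal.ofReal a₂ +
        (ENNReal.ofReal (1 / ε) * ENNReal.ofReal a₃ + ENNReal.ofReal (1 / ε) * ENNReal.ofReal a₄ +
        (ENNReal.ofReal (4 * s + L / ε) * ENNReal.ofReal a₅ +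
          ENNReal.ofReal (2 * s / ε) * ENNReal.ofReal a₆)) := by
        refine b1.trans ?_
        rw [c8, c2]
        refine add_le_add (by gcongr) (b2.trans (add_le_add (by gcongr) (b3.trans (by gcongr))))
    _ = ENNReal.ofReal (2 * a₁ + 8 * a₂ +
        (1 / ε * a₃ + 1 / ε * a₄ + ((4 * s + L / ε) * a₅ + 2 * s / ε * a₆))) := by
        rw [← ENNReal.ofReal_mul (by positivity), ← ENNReal.ofReal_mul (by positivity),
          ← ENNReal.ofReal_mul (by positivity), ← ENNReal.ofReal_mul (by positivity),
          ← ENNReal.ofReal_mul (by positivity), ← ENNReal.ofReal_mul (by positivity),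
          ← ENNReal.ofReal_add (by positivity) (by positivity),
          ← ENNReal.ofReal_add (by positivity) (by positivity),
          ← ENNReal.ofReal_add (by positivity) (by positivity),
          ← ENNReal.ofReal_add (by positivity) (by positivity),
          ← ENNReal.ofReal_add (by positivity) (by positivity)]
    _ = _ := by
        congr 1
        ring

/-- With smoothing parameter `A / r`, the error terms combine to a contraction in `K`. -/
lemma mul_le_of_smoothing_parameter {A₁ A₂ A₃ A₄ A₅ A₆ A s c rbar r ρ K x : ℝ}
    (hA : A = 4 * c * A₅ + 1) (hA0 : 0 < A) (hr : 0 < r) (hρ : 0 < ρ) (hρr : ρ ≤ r) (hK : 0 ≤ K)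
    (hB : 0 ≤ 2 * A₁ + 8 * A₂ + (A₃ + A₄) / A + 4 * s * A₅ + 2 * s * A₆ / A + A +
      rbar * c * A₅ / A)
    (hx : x ≤ 2 * (A₁ / r) + 8 * (A₂ / r) + (A₃ / r ^ 2 + A₄ / r ^ 2) / (A / r) +
      (4 * s + (2 * K * c / ρ + rbar * c / r) / (A / r)) * (A₅ / r) +
      2 * s / (A / r) * (A₆ / r ^ 2) + A / r) :
    ρ * x ≤ 2 * A₁ + 8 * A₂ + (A₃ + A₄) / A + 4 * s * A₅ + 2 * s * A₆ / A + A +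
      rbar * c * A₅ / A + K / 2 := by
  set B := 2 * A₁ + 8 * A₂ + (A₃ + A₄) / A + 4 * s * A₅ + 2 * s * A₆ / A + A +
      rbar * c * A₅ / A with hBdef
  have e : 2 * (A₁ / r) + 8 * (A₂ / r) + (A₃ / r ^ 2 + A₄ / r ^ 2) / (A / r) +
      (4 * s + (2 * K * c / ρ + rbar * c / r) / (A / r)) * (A₅ / r) +
      2 * s / (A / r) * (A₆ / r ^ 2) + A / r = B / r + 2 * K * c * A₅ / (A * ρ) := by
    have hr' := hr.ne'
    have hρ' := hρ.ne'
    have hA' := hA0.ne'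
    clear_value B
    subst hBdef
    clear hA hx
    field_simp
    ring
  have f1 : ρ * (B / r) ≤ B := by
    rw [mul_div_assoc', div_le_iff₀ hr, mul_comm]
    gcongr
  -- The contraction: A ≥ 4 c A₅ gives 2 c A₅ / A ≤ 1/2.
  have f2 : ρ * (2 * K * c * A₅ / (A * ρ)) ≤ K / 2 := by
    have : ρ * (2 * K * c * A₅ / (A * ρ)) = 2 * K * c * A₅ / A := by field_simp
    rw [this, div_le_iff₀ hA0, hA]
    nlinarith
  have f3 := mul_le_mul_of_nonneg_left (hx.trans e.le) hρ.le
  linarith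

/-! ### The main theorem -/

theorem theorem1 {Θ Ω : Type*} [MeasurableSpace Θ] [mΩ : MeasurableSpace Ω]
    -- general framework: a transition kernel and jointly measurable random variables
    (P : Kernel Θ Ω) [IsMarkovKernel P]
    (Y W' G Gbar Dbar V Bbar : Θ → Ω → ℝ) (Ψ : Θ → Ω → Θ)
    (hY : Measurable (Function.uncurry Y)) (hW' : Measurable (Function.uncurry W'))
    (hG : Measurable (Function.uncurry G)) (hGbar : Measurable (Function.uncurry Gbar))
    (hDbar : Measurable (Function.uncurry Dbar)) (hV : Measurable (Function.uncurry V))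
    (hBbar : Measurable (Function.uncurry Bbar)) (hΨ : Measurable (Function.uncurry Ψ))
    (hY2 : ∀ θ, MemLp (Y θ) 2 (P θ))
    -- (G1)
    (r : Θ → ℝ) (hr : Measurable r) (hr_pos : ∀ θ, 0 < r θ)
    (rbar : ℝ) (hrbar : 0 < rbar)
    (hVar : ∀ θ ∈ goodSet r rbar, 0 < Var[Y θ; P θ])
    -- (G2)
    (hStein : ∀ θ ∈ goodSet r rbar,
      IsSteinCoupling (P θ) (standardize P Y θ) (W' θ) (G θ))
    -- (G3)
    (hGD_int : ∀ θ ∈ goodSet r rbar,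
      Integrable (fun ω => G θ ω * couplingDiff P Y W' θ ω) (P θ))
    (hGD : ⨆ θ ∈ goodSet r rbar, ENNReal.ofReal (r θ) *
      posExp (P θ) (fun ω => |((P θ)[fun ω' => 1 - G θ ω' * couplingDiff P Y W' θ ω' |
        MeasurableSpace.comap (standardize P Y θ) inferInstance]) ω|) < ∞)
    (hWGD : ⨆ θ ∈ goodSet r rbar, ENNReal.ofReal (r θ) *
      posExp (P θ) (fun ω =>
        (1 + |standardize P Y θ ω|) * |G θ ω| * couplingDiff P Y W' θ ω ^ 2) < ∞)
    -- (G4)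
    (ℱ : Θ → MeasurableSpace Ω) (F₁ : Θ → Set Ω)
    (hℱ : ∀ θ ∈ goodSet r rbar, ℱ θ ≤ mΩ)
    (hF₁ : ∀ θ ∈ goodSet r rbar, MeasurableSet (F₁ θ))
    (hGbar_meas : ∀ θ ∈ goodSet r rbar, Measurable[ℱ θ] (Gbar θ))
    (hDbar_meas : ∀ θ ∈ goodSet r rbar, Measurable[ℱ θ] (Dbar θ))
    (hGbar_le : ∀ θ ∈ goodSet r rbar, ∀ᵐ ω ∂(P θ), ω ∈ F₁ θ → |G θ ω| ≤ Gbar θ ω)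
    (hDbar_le : ∀ θ ∈ goodSet r rbar, ∀ᵐ ω ∂(P θ), ω ∈ F₁ θ →
      |couplingDiff P Y W' θ ω| ≤ Dbar θ ω)
    (hF₁_mom : ⨆ θ ∈ goodSet r rbar, ENNReal.ofReal (r θ ^ 2) *
      posExp ((P θ).restrict (F₁ θ)ᶜ)
        (fun ω => |G θ ω| * couplingDiff P Y W' θ ω ^ 2) < ∞)
    (hbar_mom : ⨆ θ ∈ goodSet r rbar, ENNReal.ofReal (r θ) *
      posExp (P θ) (fun ω => Gbar θ ω * Dbar θ ω ^ 2) < ∞)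
    -- (G5)
    (F₂ : Θ → Set Ω)
    (hΨ_meas : ∀ θ ∈ goodSet r rbar, Measurable[ℱ θ] (Ψ θ))
    (hF₂ : ∀ θ ∈ goodSet r rbar, MeasurableSet[ℱ θ] (F₂ θ))
    (hV_law : ∀ θ ∈ goodSet r rbar, HasCondLawOn (P θ) (ℱ θ) (V θ) (F₂ θ)
      (fun ω => (P (Ψ θ ω)).map (Y (Ψ θ ω))))
    (hF₂_mom : ⨆ θ ∈ goodSet r rbar, ENNReal.ofReal (r θ ^ 2) *
      posExp ((P θ).restrict (F₂ θ)ᶜ)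
        (fun ω => |G θ ω| * couplingDiff P Y W' θ ω ^ 2) < ∞)
    -- (G6)
    (hBbar_meas : ∀ θ ∈ goodSet r rbar, Measurable[ℱ θ] (Bbar θ))
    (hBbar_le : ∀ θ ∈ goodSet r rbar, ∀ᵐ ω ∂(P θ), ω ∈ F₁ θ →
      (√Var[Y θ; P θ])⁻¹ * |Y θ ω - V θ ω| ≤ Bbar θ ω)
    (hBbar_mom : ⨆ θ ∈ goodSet r rbar, ENNReal.ofReal (r θ ^ 2) *
      posExp ((P θ).restrict (F₂ θ))
        (fun ω => Gbar θ ω * Dbar θ ω ^ 2 * Bbar θ ω) < ∞)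
    -- (G7)
    (hσ_ratio : ⨆ θ ∈ goodSet r rbar,
      essSupOn (P θ) (F₂ θ ∩ {ω | Ψ θ ω ∈ goodSet r rbar})
        (fun ω => Var[Y θ; P θ] / Var[Y (Ψ θ ω); P (Ψ θ ω)]) < ∞)
    (hr_ratio : ⨆ θ ∈ goodSet r rbar,
      essSupOn (P θ) (F₂ θ) (fun ω => r θ / r (Ψ θ ω)) < ∞)
    (hr_ratio' : ⨆ θ ∈ goodSet r rbar,
      essSupOn (P θ) (F₂ θ ∩ {ω | Ψ θ ω ∈ goodSet r rbar})
        (fun ω => r (Ψ θ ω) / r θ) < ∞) :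
    ∃ C : ℝ, ∀ θ : Θ,
      ⨆ z : ℝ, |(P θ).real {ω | standardize P Y θ ω ≤ z}
        - (gaussianReal 0 1).real (Set.Iic z)| ≤ C / r θ := by
  set W : Θ → Ω → ℝ := standardize P Y with hWdef
  set D : Θ → Ω → ℝ := couplingDiff P Y W' with hDdef
  have hgood : MeasurableSet (goodSet r rbar) := measurableSet_lt measurable_const hr
  have hYm : ∀ θ, Measurable (Y θ) := fun θ => hY.of_uncurry_left
  have hWm : ∀ θ, Measurable (W θ) := fun θ => measurable_standardize P (hYm θ)
  obtain ⟨A₁, hA₁, h₁⟩ := exists_bound_of_iSup_mul_lt_top (fun θ _ => hr_pos θ) hGD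
  obtain ⟨A₂, hA₂, h₂⟩ := exists_bound_of_iSup_mul_lt_top (fun θ _ => hr_pos θ) hWGD
  obtain ⟨A₃, hA₃, h₃⟩ := exists_bound_of_iSup_mul_lt_top
    (fun θ _ => pow_pos (hr_pos θ) 2) hF₁_mom
  obtain ⟨A₄, hA₄, h₄⟩ := exists_bound_of_iSup_mul_lt_top
    (fun θ _ => pow_pos (hr_pos θ) 2) hF₂_mom
  obtain ⟨A₅, hA₅, h₅⟩ := exists_bound_of_iSup_mul_lt_top (fun θ _ => hr_pos θ) hbar_mom
  obtain ⟨A₆, hA₆, h₆⟩ := exists_bound_of_iSup_mul_lt_top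
    (fun θ _ => pow_pos (hr_pos θ) 2) hBbar_mom
  have hF₂m : ∀ θ ∈ goodSet r rbar, MeasurableSet (F₂ θ) := fun θ hθ => hℱ θ hθ _ (hF₂ θ hθ)
  have hΨm : ∀ θ, Measurable (Ψ θ) := fun θ => hΨ.of_uncurry_left
  obtain ⟨S, hS, hSle⟩ := exists_bound_of_iSup_essSupOn_lt_top
    (fun θ hθ => (hF₂m θ hθ).inter (hΨm θ hgood)) hσ_ratio
  obtain ⟨Q, hQ, hQle⟩ := exists_bound_of_iSup_essSupOn_lt_top hF₂m hr_ratio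
  obtain ⟨κ, hκM, hκ⟩ := exists_kernel_law P hY
  -- c ≥ 1 is needed so that r θ ≤ c r ψ survives truncation: min (r θ) n ≤ c min (r ψ) n.
  set c := max Q 1 with hc
  have hc1 : 1 ≤ c := le_max_right _ _
  set s := √S with hs
  have hs0 : 0 ≤ s := Real.sqrt_nonneg _
  set A := 4 * c * A₅ + 1 with hA
  have hApos : 0 < A := by positivity
  set δ : Θ → ℝ → ℝ := fun θ z =>
    |((P θ).map (W θ)).real (Set.Iic z) - (gaussianReal 0 1).real (Set.Iic z)| with hδ
  have hprob : ∀ θ, IsProbabilityMeasure ((P θ).map (W θ)) := fun θ =>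
    Measure.isProbabilityMeasure_map (hWm θ).aemeasurable
  have hδ0 : ∀ θ z, 0 ≤ δ θ z := fun θ z => abs_nonneg _
  have hδ1 : ∀ θ z, δ θ z ≤ 1 := fun θ z => by
    have t1 : ((P θ).map (W θ)).real (Set.Iic z) ≤ 1 := measureReal_le_one
    have t2 : 0 ≤ ((P θ).map (W θ)).real (Set.Iic z) := measureReal_nonneg
    have t3 : (gaussianReal 0 1).real (Set.Iic z) ≤ 1 := measureReal_le_one
    have t4 : 0 ≤ (gaussianReal 0 1).real (Set.Iic z) := measureReal_nonneg
    rw [hδ, abs_le]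
    constructor <;> linarith
  set B := 2 * A₁ + 8 * A₂ + (A₃ + A₄) / A + 4 * s * A₅ + 2 * s * A₆ / A + A +
    rbar * c * A₅ / A with hB
  have hB0 : 0 ≤ B := by positivity
  have hstep : ∀ n > 0, ∀ K ≥ 0, (∀ θ z, min (r θ) n * δ θ z ≤ K) →
      ∀ θ z, min (r θ) n * δ θ z ≤ (B + rbar) + K / 2 := by
    intro n hn K hK hind θ z
    have hrθ := hr_pos θ
    set ρ := min (r θ) n with hρ
    have hρ0 : 0 < ρ := lt_min hrθ hn
    have hρr : ρ ≤ r θ := min_le_left _ _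
    by_cases hθ : θ ∈ goodSet r rbar
    swap
    -- Outside the good set r ≤ rbar and δ ≤ 1, which accounts for the summand rbar in the constant.
    · have h1 : r θ ≤ rbar := not_lt.mp hθ
      have h2 := mul_le_mul hρr (hδ1 θ z) (hδ0 θ z) hrθ.le
      linarith
    have hσ : 0 < √Var[Y θ; P θ] := Real.sqrt_pos.mpr (hVar θ hθ)
    -- The first summand is twice the error at a good Ψ allowed by K; the second covers Ψ outside
    -- the good set.
    set L := 2 * K * c / ρ + rbar * c / r θ with hL
    have hL1 : 0 ≤ 2 * K * c / ρ := by positivity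
    have hL2 : 0 ≤ rbar * c / r θ := by positivity
    have hconc : ∀ᵐ ω ∂(P θ), ω ∈ F₂ θ → ∀ u v, u ≤ v →
        (κ (Ψ θ ω)).real (Set.Ioc (∫ ω', Y θ ω' ∂(P θ) + √Var[Y θ; P θ] * u)
          (∫ ω', Y θ ω' ∂(P θ) + √Var[Y θ; P θ] * v)) ≤ s * (v - u) + L := by
      filter_upwards [hSle θ hθ, hQle θ hθ] with ω hω₁ hω₂ hω u v huv
      set ψ := Ψ θ ω with hψ
      have hrψ := hr_pos ψ
      have hrr : r θ ≤ c * r ψ := by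
        rw [← div_le_iff₀ hrψ]
        exact (hω₂ hω).trans (le_max_left _ _)
      have hsuv : 0 ≤ s * (v - u) := mul_nonneg hs0 (sub_nonneg.mpr huv)
      by_cases hψg : ψ ∈ goodSet r rbar
      · have hVψ := hVar ψ hψg
        have hss : √Var[Y θ; P θ] / √Var[Y ψ; P ψ] ≤ s := by
          rw [← Real.sqrt_div (variance_nonneg _ _)]
          exact Real.sqrt_le_sqrt (hω₁ ⟨hω, hψg⟩)
        have hρψ : 0 < min (r ψ) n := lt_min hrψ hn
        have hdel : ∀ z, δ ψ z ≤ K * c / ρ := fun z => by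
          have h1 : ρ ≤ c * min (r ψ) n := by
            rw [mul_min_of_nonneg _ _ (by linarith)]
            exact min_le_min hrr (by nlinarith)
          rw [le_div_iff₀ hρ0]
          have h2 := hind ψ z
          have h3 := mul_le_mul_of_nonneg_left h1 (hδ0 ψ z)
          nlinarith
        rw [hκ]
        have := map_real_Ioc_le (hYm ψ) (hWm ψ) (Real.sqrt_pos.mpr hVψ)
          (eq_add_mul_standardize P Y hVψ) hdel (m := ∫ ω', Y θ ω' ∂(P θ)) hσ.le hss huv
        have e : 2 * (K * c / ρ) = 2 * K * c / ρ := by ring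
        linarith
      -- If ψ is not good then r θ ≤ c rbar, so the trivial bound 1 is already at most rbar c / r θ.
      · have h1 : r ψ ≤ rbar := not_lt.mp hψg
        have h2 : 1 ≤ rbar * c / r θ := by
          rw [le_div_iff₀ hrθ]
          nlinarith
        have h3 : (κ ψ).real (Set.Ioc (∫ ω', Y θ ω' ∂(P θ) + √Var[Y θ; P θ] * u)
          (∫ ω', Y θ ω' ∂(P θ) + √Var[Y θ; P θ] * v)) ≤ 1 := measureReal_le_one
        linarith
    have hνp : ∀ ω, IsProbabilityMeasure ((P (Ψ θ ω)).map (Y (Ψ θ ω))) := fun ω =>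
      Measure.isProbabilityMeasure_map (hYm _).aemeasurable
    -- The smoothing width is A / r θ.
    have hbound := (hStein θ hθ).kolmogorov_le (D := D θ) (hWm θ) hW'.of_uncurry_left
      hG.of_uncurry_left (fun ω => rfl) (hGD_int θ hθ) hGbar.of_uncurry_left
      hDbar.of_uncurry_left hBbar.of_uncurry_left hV.of_uncurry_left (hΨm θ) κ (hF₁ θ hθ)
      (hF₂m θ hθ) (fun T hT E hE => by
        have hX := (hGbar_meas θ hθ).prodMk ((hDbar_meas θ hθ).prodMk
          ((hBbar_meas θ hθ).prodMk (hΨ_meas θ hθ)))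
        simp only [hκ]
        exact (hV_law θ hθ).measure_inter_eq (hℱ θ hθ) hV.of_uncurry_left (hF₂ θ hθ)
          (hX hT) hE) hσ hs0 (add_nonneg hL1 hL2) (div_pos hApos hrθ)
      (eq_add_mul_standardize P Y (hVar θ hθ)) hconc (hGbar_le θ hθ) (hDbar_le θ hθ)
      (hBbar_le θ hθ) (by positivity) (by positivity) (by positivity) (by positivity)
      (by positivity) (by positivity) (h₁ θ hθ) (h₂ θ hθ) (h₃ θ hθ) (h₄ θ hθ) (h₅ θ hθ)
      (h₆ θ hθ) z
    have := mul_le_of_smoothing_parameter hA hApos hrθ hρ0 hρr hK hB0 hbound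
    linarith
  have hfinal := mul_le_of_self_improving hr_pos hδ0 hδ1 hstep
  refine ⟨2 * (B + rbar), fun θ => ciSup_le fun z => ?_⟩
  rw [le_div_iff₀ (hr_pos θ), mul_comm]
  have := hfinal θ z
  simp only [hδ] at this
  rwa [map_measureReal_apply (hWm θ) measurableSet_Iic] at this
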